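/- Fix constants \(K,\gamma\in(0,\infty)\) and a probability space. For each integer \(n\ge 1\) let \(N=N(n)\) and \(M=M(n)\) be positive integers with \(M\le N\), and assume the following. (A1) \(\Sigma_n=\mathbf U_n\,\mathrm{diag}(l^{(n)}_1,\dots,l^{(n)}_M,1,\dots,1)\,\mathbf U_n^T\in\mathbb R^{N\times N}\) is deterministic, with \(\mathbf U_n\in\mathbb R^{N\times N}\) orthogonal and \(l^{(n)}_1\ge l^{(n)}_2\ge\dots\ge l^{(n)}_M\ge 1\). (A2) \(\mathbf X_n=\mathbf U_n\,\mathrm{diag}\bigl(\sqrt{l^{(n)}_1},\dots,\sqrt{l^{(n)}_M},1,\dots,1\bigr)\mathbf Z_n\in\mathbb R^{N\times n}\), where for each \(n\) the entries of \(\mathbf Z_n=(z^{(n)}_{ij})_{1\le i\le N,\,1\le j\le n}\) are i.i.d. real random variables on the given probability space with \(\mathbb E[z^{(n)}_{11}]=0\), \(\mathbb E[(z^{(n)}_{11})^2]=1\) and \(\|z^{(n)}_{11}\|_{\psi_2}\le K\), with \(\|Y\|_{\psi_2}=\inf\{t>0:\mathbb E[\exp(Y^2/t^2)]\le 2\}\).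 (Nothing is assumed about the joint law of \(\mathbf Z_n\) for different \(n\).) (A3) \(\frac1\gamma\le\frac{N(n)}{n}\le\gamma\) for all \(n\). (A4) \(\lim_{n\to\infty}\frac{M(n)}{n}=0\). Let \(\hat l^{(n)}_1\ge\hat l^{(n)}_2\ge\dots\ge\hat l^{(n)}_M\) be the \(M\) largest eigenvalues, counted with multiplicity, of the sample covariance matrix \(\mathbf S_n=\frac1n\mathbf X_n\mathbf X_n^T\). Let \(\nu(n)\in\{1,\dots,M(n)\}\) for every \(n\), and suppose that \(\lim_{n\to\infty}l^{(n)}_{\nu(n)}=\infty\). Then, jointly (that is, uniformly) for all \(k\in\{1,\dots,\nu(n)\}\), \(\hat l^{(n)}_k/l^{(n)}_k\to1\) almost surely: \[ \max_{1\le k\le\nu(n)}\left|\frac{\hat l^{(n)}_k}{l^{(n)}_k}-1\right|\longrightarrow 0\quad\text{almost surely as } n\to\infty . \] -/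

import Mathlib

open MeasureTheory ProbabilityTheory Filter Topology

noncomputable section

namespace SpikedCovariance

/-- The spectrum `(l_1, …, l_M, 1, …, 1)` of length `N` (indices start at `0`). -/
def spikedSpectrum {M : ℕ} (N : ℕ) (l : Fin M → ℝ) : Fin N → ℝ :=
  fun i => if h : (i : ℕ) < M then l ⟨i, h⟩ else 1

/-- The spiked covariance model: `Σ = U diag(l_1, …, l_M, 1, …, 1) Uᵀ` is an `N × N` matrix with
`U` orthogonal and `l_1 ≥ l_2 ≥ … ≥ l_M ≥ 1`. -/
structure IsSpikedCovariance {N M : ℕ} (Sigma U : Matrix (Fin N) (Fin N) ℝ)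
    (l : Fin M → ℝ) : Prop where
  card_le : M ≤ N
  orthogonal : U ∈ Matrix.orthogonalGroup (Fin N) ℝ
  antitone : Antitone l
  one_le : ∀ i, 1 ≤ l i
  eq : Sigma = U * Matrix.diagonal (spikedSpectrum N l) * U.transpose

/-- The subgaussian norm `‖Y‖_{ψ₂} = inf {t > 0 : E[exp(Y² / t²)] ≤ 2}`, with values in `[0, ∞]`
(it is `∞` if there is no such `t`). -/
def psi2Norm {Ω : Type*} [MeasurableSpace Ω] (μ : Measure Ω) (Y : Ω → ℝ) : ENNReal :=
  sInf {s | ∃ t : ℝ, 0 < t ∧ s = ENNReal.ofReal t ∧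
    ∫⁻ ω, ENNReal.ofReal (Real.exp (Y ω ^ 2 / t ^ 2)) ∂μ ≤ 2}

/-- The data matrix is `X = U diag(√l_1, …, √l_M, 1, …, 1) Z`, where `Z` is an `N × n` random
matrix with i.i.d. entries of mean zero, variance one, and subgaussian norm at most `K`. -/
structure IsSpikedSample {Ω : Type*} [MeasurableSpace Ω] (μ : Measure Ω) (K : ℝ) {N M n : ℕ}
    (U : Matrix (Fin N) (Fin N) ℝ) (l : Fin M → ℝ)
    (Z X : Ω → Matrix (Fin N) (Fin n) ℝ) : Prop where
  eq : ∀ ω, X ω = U * Matrix.diagonal (fun i => Real.sqrt (spikedSpectrum N l i)) * Z ω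
  measurable : ∀ i j, Measurable fun ω => Z ω i j
  indep : iIndepFun (fun (p : Fin N × Fin n) ω => Z ω p.1 p.2) μ
  identDistrib : ∀ i j i' j', IdentDistrib (fun ω => Z ω i j) (fun ω => Z ω i' j') μ μ
  mean : ∀ i j, ∫ ω, Z ω i j ∂μ = 0
  second_moment : ∀ i j, ∫ ω, Z ω i j ^ 2 ∂μ = 1
  psi2Norm_le : ∀ i j, psi2Norm μ (fun ω => Z ω i j) ≤ ENNReal.ofReal K

/-- The sample covariance matrix `S = (1/n) X Xᵀ`. -/
def sampleCovariance {N n : ℕ} (X : Matrix (Fin N) (Fin n) ℝ) : Matrix (Fin N) (Fin N) ℝ :=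
  (1 / (n : ℝ)) • (X * X.transpose)

theorem isHermitian_sampleCovariance {N n : ℕ} (X : Matrix (Fin N) (Fin n) ℝ) :
    (sampleCovariance X).IsHermitian := by
  unfold sampleCovariance Matrix.IsHermitian
  simp [Matrix.conjTranspose_eq_transpose_of_trivial, Matrix.transpose_mul]

/-- The eigenvalues of the sample covariance matrix, listed with multiplicity in decreasing order:
index `k` (starting at `0`) gives the `(k+1)`-th largest one. -/
def sampleEigenvalue {N n : ℕ} (X : Matrix (Fin N) (Fin n) ℝ) (k : Fin N) : ℝ :=
  (isHermitian_sampleCovariance X).eigenvalues₀ (Fin.cast (Fintype.card_fin N).symm k)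

end SpikedCovariance

end

/-! With `w = Uᵀ v`, the quadratic form of the sample covariance at `v` is `‖Zᵀ y‖² / n`, where `y`
is `w` scaled coordinatewise by the square roots of the population eigenvalues. Two uniform
estimates on `Z` suffice: `‖Zᵀ y‖² = (1 ± e) n ‖y‖²` for `y` supported on the first `M` coordinates,
and `‖Zᵀ y‖² ≤ C n ‖y‖²` for every `y`. Min-max with test spaces cut out by coordinates of `w` then
gives `(1 - e) l_k ≤ l̂_k ≤ (1 + e)² l_k + (1 + 1/e) C` (`le_sampleEigenvalue_spiked`,
`sampleEigenvalue_spiked_le`). The additive error is negligible relative to `l_k ≥ l_ν → ∞`,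
uniformly in `k ≤ ν`.

Both estimates come from `exists_measure_exists_quadForm_le`: Bernstein's inequality for a fixed
vector, then a union bound over pairs from a `1/2`-net, at entropy cost `25 ^ dim`. In dimension `M
= o(n)` any deviation level is affordable; in dimension `N ≤ γ n` a large constant level is. Failure
probabilities decay geometrically, so the first Borel–Cantelli lemma gives almost sure statements
with no assumption on the joint law across `n` (`ae_eventually_quadForm_le`). -/

namespace SpikedCovariance

/-! ### Min-max bounds for eigenvalues -/

section MinMax

variable {E : Type*} [NormedAddCommGroup E] [InnerProductSpace ℝ E] [FiniteDimensional ℝ E]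

/-- In dimension `n`, `n - 1` linear conditions have a common nonzero solution. -/
theorem exists_ne_zero_forall_eq_zero {n : ℕ} (hn : Module.finrank ℝ E = n) (k : Fin n)
    (f g : Fin n → E →ₗ[ℝ] ℝ) :
    ∃ v : E, v ≠ 0 ∧ (∀ i, k < i → f i v = 0) ∧ ∀ i, i < k → g i v = 0 := by
  let L : E →ₗ[ℝ] ({i : Fin n // i ≠ k} → ℝ) :=
    LinearMap.pi fun i => if k < i.1 then f i else g i
  have hL : L.ker ≠ ⊥ := by
    apply LinearMap.ker_ne_bot_of_finrank_lt
    have hk := k.2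
    simp only [Module.finrank_fintype_fun_eq_card, Fintype.card_subtype_compl,
      Fintype.card_fin, Fintype.card_subtype_eq, ne_eq, hn]
    omega
  obtain ⟨v, hv, hv0⟩ := Submodule.exists_mem_ne_zero_of_ne_bot hL
  have hcoord : ∀ i : {i : Fin n // i ≠ k}, (if k < i.1 then f i else g i) v = 0 := fun i =>
    congrFun (LinearMap.mem_ker.1 hv) i
  refine ⟨v, hv0, fun i hi => ?_, fun i hi => ?_⟩
  · simpa [hi] using hcoord ⟨i, hi.ne'⟩
  · simpa [hi.le.not_gt] using hcoord ⟨i, hi.ne⟩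

theorem inner_apply_eq_sum_eigenvalues {T : E →ₗ[ℝ] E} (hT : T.IsSymmetric) {n : ℕ}
    (hn : Module.finrank ℝ E = n) (v : E) :
    inner ℝ v (T v) =
      ∑ i, hT.eigenvalues hn i * ‖inner ℝ (hT.eigenvectorBasis hn i) v‖ ^ 2 := by
  rw [← (hT.eigenvectorBasis hn).sum_inner_mul_inner]
  refine Finset.sum_congr rfl fun i _ => ?_
  rw [← hT, hT.apply_eigenvectorBasis hn i, real_inner_comm, Real.norm_eq_abs, sq_abs]
  simp only [RCLike.ofReal_real_eq_id, id_eq, inner_smul_left, conj_trivial]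
  ring

/-- Lower half of the min-max principle. -/
theorem le_eigenvalue_of_forall {T : E →ₗ[ℝ] E} (hT : T.IsSymmetric) {n : ℕ}
    (hn : Module.finrank ℝ E = n) (k : Fin n) (f : Fin n → E →ₗ[ℝ] ℝ) {c : ℝ}
    (h : ∀ v, (∀ i, k < i → f i v = 0) → c * ‖v‖ ^ 2 ≤ inner ℝ v (T v)) :
    c ≤ hT.eigenvalues hn k := by
  let b := hT.eigenvectorBasis hn
  obtain ⟨v, hv, hf, hg⟩ := exists_ne_zero_forall_eq_zero hn k f
    fun i => (innerSL ℝ (b i) : E →L[ℝ] ℝ).toLinearMap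
  -- `v` has no component along the first `k` eigenvectors, so only eigenvalues at most the `k`-th
  -- contribute.
  have hle : inner ℝ v (T v) ≤ hT.eigenvalues hn k * ‖v‖ ^ 2 := by
    rw [inner_apply_eq_sum_eigenvalues hT hn, ← b.sum_sq_norm_inner_right, Finset.mul_sum]
    refine Finset.sum_le_sum fun i _ => ?_
    rcases lt_or_ge i k with hi | hi
    · have : inner ℝ (b i) v = 0 := hg i hi
      simp [b, this]
    · exact mul_le_mul_of_nonneg_right (hT.eigenvalues_antitone hn hi) (sq_nonneg _)
  have hpos : 0 < ‖v‖ ^ 2 := by positivity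
  exact le_of_mul_le_mul_right ((h v hf).trans hle) hpos

/-- Upper half of the min-max principle. -/
theorem eigenvalue_le_of_forall {T : E →ₗ[ℝ] E} (hT : T.IsSymmetric) {n : ℕ}
    (hn : Module.finrank ℝ E = n) (k : Fin n) (g : Fin n → E →ₗ[ℝ] ℝ) {c : ℝ}
    (h : ∀ v, (∀ i, i < k → g i v = 0) → inner ℝ v (T v) ≤ c * ‖v‖ ^ 2) :
    hT.eigenvalues hn k ≤ c := by
  let b := hT.eigenvectorBasis hn
  obtain ⟨v, hv, hf, hg⟩ := exists_ne_zero_forall_eq_zero hn k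
    (fun i => (innerSL ℝ (b i) : E →L[ℝ] ℝ).toLinearMap) g
  have hle : hT.eigenvalues hn k * ‖v‖ ^ 2 ≤ inner ℝ v (T v) := by
    rw [inner_apply_eq_sum_eigenvalues hT hn, ← b.sum_sq_norm_inner_right, Finset.mul_sum]
    refine Finset.sum_le_sum fun i _ => ?_
    rcases lt_or_ge k i with hi | hi
    · have : inner ℝ (b i) v = 0 := hf i hi
      simp [b, this]
    · exact mul_le_mul_of_nonneg_right (hT.eigenvalues_antitone hn hi) (sq_nonneg _)
  have hpos : 0 < ‖v‖ ^ 2 := by positivity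
  exact le_of_mul_le_mul_right (hle.trans (h v hg)) hpos

end MinMax

/-! ### Deterministic sandwich for the sample eigenvalues -/

section Sample

open Matrix

variable {N n : ℕ}

/-- `‖Zᵀ y‖²`, written with dot products. -/
def gram (Z : Matrix (Fin N) (Fin n) ℝ) (y : Fin N → ℝ) : ℝ := (Zᵀ *ᵥ y) ⬝ᵥ (Zᵀ *ᵥ y)

theorem inner_toLpLin_sampleCovariance (X : Matrix (Fin N) (Fin n) ℝ)
    (v : EuclideanSpace ℝ (Fin N)) :
    inner ℝ v (toLpLin 2 2 (sampleCovariance X) v) = 1 / (n : ℝ) * gram X v.ofLp := by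
  rw [toLpLin_apply, EuclideanSpace.inner_eq_star_dotProduct]
  simp only [sampleCovariance, gram, star_trivial, smul_mulVec, smul_dotProduct, smul_eq_mul]
  rw [← mulVec_mulVec, dotProduct_comm, dotProduct_mulVec, ← mulVec_transpose]

theorem gram_spiked {U : Matrix (Fin N) (Fin N) ℝ} (d : Fin N → ℝ) (Z : Matrix (Fin N) (Fin n) ℝ)
    (v : Fin N → ℝ) :
    gram (U * diagonal d * Z) v = gram Z (fun i => d i * (Uᵀ *ᵥ v) i) := by
  have : (U * diagonal d * Z)ᵀ *ᵥ v = Zᵀ *ᵥ (fun i => d i * (Uᵀ *ᵥ v) i) := by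
    rw [transpose_mul, transpose_mul, diagonal_transpose, ← mulVec_mulVec, ← mulVec_mulVec]
    congr 1
    ext i
    rw [mulVec_diagonal]
  rw [gram, gram, this]

theorem sum_sq_transpose_mulVec {U : Matrix (Fin N) (Fin N) ℝ}
    (hU : U ∈ orthogonalGroup (Fin N) ℝ) (v : EuclideanSpace ℝ (Fin N)) :
    ∑ i, (Uᵀ *ᵥ v.ofLp) i ^ 2 = ‖v‖ ^ 2 := by
  rw [EuclideanSpace.real_norm_sq_eq]
  have h1 : U * Uᵀ = 1 := by
    simpa [star_eq_conjTranspose, conjTranspose_eq_transpose_of_trivial] using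
      (mem_orthogonalGroup_iff _ _).1 hU
  have h2 : (Uᵀ *ᵥ v.ofLp) ⬝ᵥ (Uᵀ *ᵥ v.ofLp) = v.ofLp ⬝ᵥ v.ofLp := by
    rw [dotProduct_mulVec, ← mulVec_transpose, transpose_transpose, mulVec_mulVec, h1, one_mulVec]
  simpa [dotProduct, sq] using h2

/-- Young's inequality `2ab ≤ ε a² + b² / ε` in each coordinate. It separates spiked from unspiked
coordinates with only a factor `1 + ε` on the spiked part. -/
theorem gram_add_le (Z : Matrix (Fin N) (Fin n) ℝ) (x y : Fin N → ℝ) {ε : ℝ} (hε : 0 < ε) :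
    gram Z (x + y) ≤ (1 + ε) * gram Z x + (1 + 1 / ε) * gram Z y := by
  simp only [gram, mulVec_add, dotProduct, Pi.add_apply, Finset.mul_sum]
  rw [← Finset.sum_add_distrib]
  refine Finset.sum_le_sum fun i _ => ?_
  set a := (Zᵀ *ᵥ x) i
  set b := (Zᵀ *ᵥ y) i
  have h : (1 + ε) * (a * a) + (1 + 1 / ε) * (b * b) - (a + b) * (a + b) =
      (ε * a - b) ^ 2 / ε := by
    field_simp
    ring
  have : 0 ≤ (ε * a - b) ^ 2 / ε := by positivity
  linarith

theorem one_le_spikedSpectrum {M : ℕ} {l : Fin M → ℝ} (hl : ∀ i, 1 ≤ l i) (i : Fin N) :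
    1 ≤ spikedSpectrum N l i := by
  unfold spikedSpectrum
  split_ifs
  exacts [hl _, le_rfl]

/-- Test on the vectors with `(Uᵀ v) i = 0` for `i > k`: the scaled vector is supported on spiked
coordinates, and each surviving population eigenvalue is at least `l k`. -/
theorem le_sampleEigenvalue_spiked {M : ℕ} (hn : 0 < n) {U : Matrix (Fin N) (Fin N) ℝ}
    (hU : U ∈ orthogonalGroup (Fin N) ℝ) {l : Fin M → ℝ} (hM : M ≤ N) (hl : Antitone l)
    (hl1 : ∀ i, 1 ≤ l i) (Z : Matrix (Fin N) (Fin n) ℝ) {ε : ℝ} (hε : ε ≤ 1)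
    (hZ : ∀ y : Fin N → ℝ, (∀ i : Fin N, M ≤ (i : ℕ) → y i = 0) →
      (1 - ε) * (n * ∑ i, y i ^ 2) ≤ gram Z y) (k : Fin M) :
    (1 - ε) * l k ≤
      sampleEigenvalue (U * diagonal (fun i => Real.sqrt (spikedSpectrum N l i)) * Z)
        (Fin.castLE hM k) := by
  set X := U * diagonal (fun i => Real.sqrt (spikedSpectrum N l i)) * Z with hX
  have hn' : (0 : ℝ) < n := by exact_mod_cast hn
  refine le_eigenvalue_of_forall (isSymmetric_toEuclideanLin_iff.mpr
    (isHermitian_sampleCovariance X)) finrank_euclideanSpace _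
    (fun i => (LinearMap.proj (Fin.cast (Fintype.card_fin N) i)) ∘ₗ (Uᵀ).mulVecLin ∘ₗ
      (WithLp.linearEquiv 2 ℝ (Fin N → ℝ)).toLinearMap) fun v hv => ?_
  have hv' : ∀ i : Fin N, Fin.castLE hM k < i → (Uᵀ *ᵥ v.ofLp) i = 0 := fun i hi =>
    hv (Fin.cast (Fintype.card_fin N).symm i) hi
  erw [inner_toLpLin_sampleCovariance]
  rw [hX, gram_spiked, ← sum_sq_transpose_mulVec hU]
  set w := Uᵀ *ᵥ v.ofLp
  have hy := hZ (fun i => Real.sqrt (spikedSpectrum N l i) * w i) fun i hi => by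
    have : Fin.castLE hM k < i := by
      rw [Fin.lt_def, Fin.val_castLE]; omega
    simp [hv' i this]
  have hsum : l k * ∑ i, w i ^ 2 ≤ ∑ i, (Real.sqrt (spikedSpectrum N l i) * w i) ^ 2 := by
    rw [Finset.mul_sum]
    refine Finset.sum_le_sum fun i _ => ?_
    rw [mul_pow, Real.sq_sqrt (zero_le_one.trans (one_le_spikedSpectrum hl1 i))]
    rcases lt_or_ge (Fin.castLE hM k) i with hi | hi
    · simp [hv' i hi]
    · refine mul_le_mul_of_nonneg_right ?_ (sq_nonneg _)
      have hi' : (i : ℕ) ≤ k := hi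
      have : (i : ℕ) < M := hi'.trans_lt k.2
      simp only [spikedSpectrum, this, dite_true]
      exact hl hi'
  calc (1 - ε) * l k * ∑ i, w i ^ 2 = (1 - ε) * (l k * ∑ i, w i ^ 2) := by ring
    _ ≤ (1 - ε) * ∑ i, (Real.sqrt (spikedSpectrum N l i) * w i) ^ 2 :=
      mul_le_mul_of_nonneg_left hsum (by linarith)
    _ = 1 / (n : ℝ) * ((1 - ε) * (n * ∑ i, (Real.sqrt (spikedSpectrum N l i) * w i) ^ 2)) := by
      field_simp
    _ ≤ _ := mul_le_mul_of_nonneg_left hy (by positivity)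

/-- Test on the vectors with `(Uᵀ v) i = 0` for `i < k`. The spiked part of the scaled vector has
squared norm at most `l k * ‖v‖²`. The unspiked part is not amplified, so the crude bound `C` is
enough there. -/
theorem sampleEigenvalue_spiked_le {M : ℕ} (hn : 0 < n) {U : Matrix (Fin N) (Fin N) ℝ}
    (hU : U ∈ orthogonalGroup (Fin N) ℝ) {l : Fin M → ℝ} (hM : M ≤ N) (hl : Antitone l)
    (hl1 : ∀ i, 1 ≤ l i) (Z : Matrix (Fin N) (Fin n) ℝ) {ε C : ℝ} (hε : 0 < ε) (hC : 0 ≤ C)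
    (hZ : ∀ y : Fin N → ℝ, (∀ i : Fin N, M ≤ (i : ℕ) → y i = 0) →
      gram Z y ≤ (1 + ε) * (n * ∑ i, y i ^ 2))
    (hZC : ∀ y : Fin N → ℝ, gram Z y ≤ C * (n * ∑ i, y i ^ 2)) (k : Fin M) :
    sampleEigenvalue (U * diagonal (fun i => Real.sqrt (spikedSpectrum N l i)) * Z)
        (Fin.castLE hM k) ≤ (1 + ε) ^ 2 * l k + (1 + 1 / ε) * C := by
  set X := U * diagonal (fun i => Real.sqrt (spikedSpectrum N l i)) * Z with hX
  have hn' : (0 : ℝ) < n := by exact_mod_cast hn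
  refine eigenvalue_le_of_forall (isSymmetric_toEuclideanLin_iff.mpr
    (isHermitian_sampleCovariance X)) finrank_euclideanSpace _
    (fun i => (LinearMap.proj (Fin.cast (Fintype.card_fin N) i)) ∘ₗ (Uᵀ).mulVecLin ∘ₗ
      (WithLp.linearEquiv 2 ℝ (Fin N → ℝ)).toLinearMap) fun v hv => ?_
  have hv' : ∀ i : Fin N, i < Fin.castLE hM k → (Uᵀ *ᵥ v.ofLp) i = 0 := fun i hi =>
    hv (Fin.cast (Fintype.card_fin N).symm i) hi
  erw [inner_toLpLin_sampleCovariance]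
  rw [hX, gram_spiked, ← sum_sq_transpose_mulVec hU]
  set w := Uᵀ *ᵥ v.ofLp
  let y₁ : Fin N → ℝ := fun i => if (i : ℕ) < M then Real.sqrt (spikedSpectrum N l i) * w i else 0
  let y₂ : Fin N → ℝ := fun i => if (i : ℕ) < M then 0 else w i
  have hy : (fun i => Real.sqrt (spikedSpectrum N l i) * w i) = y₁ + y₂ := by
    ext i
    by_cases hi : (i : ℕ) < M
    · simp [y₁, y₂, hi]
    · simp [y₁, y₂, hi, spikedSpectrum]
  have h1 : ∑ i, y₁ i ^ 2 ≤ l k * ∑ i, w i ^ 2 := by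
    rw [Finset.mul_sum]
    refine Finset.sum_le_sum fun i _ => ?_
    by_cases hi : (i : ℕ) < M
    · simp only [y₁, hi, if_true]
      rw [mul_pow, Real.sq_sqrt (zero_le_one.trans (one_le_spikedSpectrum hl1 i))]
      rcases lt_or_ge i (Fin.castLE hM k) with hk | hk
      · simp [hv' i hk]
      · refine mul_le_mul_of_nonneg_right ?_ (sq_nonneg _)
        simp only [spikedSpectrum, hi, dite_true]
        exact hl hk
    · simp only [y₁, hi, if_false]
      have : 0 ≤ l k := zero_le_one.trans (hl1 k)
      rw [zero_pow two_ne_zero]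
      positivity
  have h2 : ∑ i, y₂ i ^ 2 ≤ ∑ i, w i ^ 2 := by
    refine Finset.sum_le_sum fun i _ => ?_
    by_cases hi : (i : ℕ) < M
    · simp only [y₂, hi, if_true, zero_pow two_ne_zero]; positivity
    · simp [y₂, hi]
  have hy1 := hZ y₁ fun i hi => by simp [y₁, not_lt.2 hi]
  have hy2 := hZC y₂
  rw [hy]
  calc 1 / (n : ℝ) * gram Z (y₁ + y₂)
      ≤ 1 / (n : ℝ) * ((1 + ε) * ((1 + ε) * (n * (l k * ∑ i, w i ^ 2))) +
          (1 + 1 / ε) * (C * (n * ∑ i, w i ^ 2))) := by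
        refine mul_le_mul_of_nonneg_left ((gram_add_le Z y₁ y₂ hε).trans ?_) (by positivity)
        refine add_le_add (mul_le_mul_of_nonneg_left (hy1.trans ?_) (by positivity))
          (mul_le_mul_of_nonneg_left (hy2.trans ?_) (by positivity))
        · gcongr
        · gcongr
    _ = _ := by
      field_simp

end Sample

/-! ### Subgaussian variables and their squares -/

section Subgaussian

variable {Ω : Type*} [MeasurableSpace Ω] {μ : Measure Ω}

/-- Blocks of an independent family indexed by pairs are independent. -/
theorem iIndepFun_curry {ι κ : Type*} {X : ι × κ → Ω → ℝ} (hX : ∀ p, Measurable (X p))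
    (h : iIndepFun X μ) : iIndepFun (fun i ω (j : κ) => X (i, j) ω) μ := by
  have := h.isProbabilityMeasure
  have hs : iIndepFun (fun (p : (_ : ι) × κ) => X (p.1, p.2)) μ :=
    h.precomp (g := fun p : (_ : ι) × κ => (p.1, p.2)) (Equiv.sigmaEquivProd ι κ).injective
  have hP : ∀ i j, IsProbabilityMeasure (μ.map (X (i, j))) :=
    fun i j => Measure.isProbabilityMeasure_map (hX _).aemeasurable
  -- Independence is expressed as the joint law being a product measure, and currying carries the
  -- product over pairs to an iterated product.
  have hc : (MeasurableEquiv.piCurry fun (_ : ι) (_ : κ) => ℝ) ∘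
      (fun ω (p : (_ : ι) × κ) => X (p.1, p.2) ω) = fun ω i j => X (i, j) ω := by
    ext; simp [Sigma.curry]
  have hmap := (iIndepFun_iff_map_fun_eq_infinitePi_map (fun p => hX _)).1 hs
  rw [iIndepFun_iff_map_fun_eq_infinitePi_map (by fun_prop), ← hc,
    ← Measure.map_map (by fun_prop) (by fun_prop), hmap,
    Measure.infinitePi_map_piCurry (fun i j => μ.map (X (i, j)))]
  congr 1
  ext1 i
  have hi : iIndepFun (fun j => X (i, j)) μ :=
    h.precomp (g := fun j => (i, j)) (Prod.mk_right_injective i)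
  exact ((iIndepFun_iff_map_fun_eq_infinitePi_map (fun j => hX _)).1 hi).symm

theorem exp_le_one_add_add_sq_mul_exp_abs (x : ℝ) :
    Real.exp x ≤ 1 + x + x ^ 2 * Real.exp |x| := by
  have h := Complex.norm_exp_sub_sum_le_norm_mul_exp (x : ℂ) 2
  have h2 : Complex.exp x - ∑ m ∈ Finset.range 2, (x : ℂ) ^ m / (m.factorial : ℂ) =
      ((Real.exp x - (1 + x) : ℝ) : ℂ) := by
    simp [Finset.sum_range_succ]
  rw [h2, Complex.norm_real, Complex.norm_real, Real.norm_eq_abs, Real.norm_eq_abs, sq_abs] at h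
  linarith [le_abs_self (Real.exp x - (1 + x))]

/-- Doubling `K` makes the bound on the infimum strict, so an admissible `t ≤ 2 * K` exists without
showing that the infimum is attained. -/
theorem lintegral_exp_sq_le_of_psi2Norm_le {K : ℝ} (hK : 0 < K) {Y : Ω → ℝ}
    (h : psi2Norm μ Y ≤ ENNReal.ofReal K) :
    ∫⁻ ω, ENNReal.ofReal (Real.exp (Y ω ^ 2 / (2 * K) ^ 2)) ∂μ ≤ 2 := by
  have hlt : psi2Norm μ Y < ENNReal.ofReal (2 * K) :=
    h.trans_lt ((ENNReal.ofReal_lt_ofReal_iff (by positivity)).2 (by linarith))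
  obtain ⟨s, ⟨t, ht, rfl, hs⟩, hst⟩ := sInf_lt_iff.1 hlt
  have htK : t ≤ 2 * K := ((ENNReal.ofReal_lt_ofReal_iff (by positivity)).1 hst).le
  refine (lintegral_mono fun ω => ?_).trans hs
  gcongr

theorem integrable_exp_of_lintegral_le {f : Ω → ℝ} (hf : Measurable f) {B : ℝ}
    (h : ∫⁻ ω, ENNReal.ofReal (Real.exp (f ω)) ∂μ ≤ ENNReal.ofReal B) :
    Integrable (fun ω => Real.exp (f ω)) μ := by
  refine ⟨by fun_prop, ?_⟩
  rw [hasFiniteIntegral_iff_ofReal (Eventually.of_forall fun ω => (Real.exp_pos _).le)]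
  exact h.trans_lt ENNReal.ofReal_lt_top

theorem integral_exp_le_of_lintegral_le {f : Ω → ℝ} (hf : Measurable f) {B : ℝ} (hB : 0 ≤ B)
    (h : ∫⁻ ω, ENNReal.ofReal (Real.exp (f ω)) ∂μ ≤ ENNReal.ofReal B) :
    ∫ ω, Real.exp (f ω) ∂μ ≤ B := by
  rw [integral_eq_lintegral_of_nonneg_ae (Eventually.of_forall fun ω => (Real.exp_pos _).le)
    (by fun_prop)]
  exact ENNReal.toReal_le_of_le_ofReal hB h

variable [IsProbabilityMeasure μ]

theorem integral_one_add_mul_add_mul {f g : Ω → ℝ} (hf : Integrable f μ) (hg : Integrable g μ)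
    (s c : ℝ) : ∫ ω, (1 + s * f ω + c * g ω) ∂μ = 1 + s * ∫ ω, f ω ∂μ + c * ∫ ω, g ω ∂μ := by
  have h1 : Integrable (fun ω => 1 + s * f ω) μ := (integrable_const _).add (hf.const_mul _)
  rw [integral_add h1 (hg.const_mul _), integral_add (integrable_const _) (hf.const_mul _),
    integral_const_mul, integral_const_mul]
  simp

/-- A centered random variable with `E exp (Y² / t²) ≤ 2` has a subgaussian mgf. -/
theorem hasSubgaussianMGF_of_lintegral_exp_sq_le {t : ℝ} (ht : 0 < t) {Y : Ω → ℝ}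
    (hY : Measurable Y) (hi : Integrable Y μ) (h0 : ∫ ω, Y ω ∂μ = 0)
    (h : ∫⁻ ω, ENNReal.ofReal (Real.exp (Y ω ^ 2 / t ^ 2)) ∂μ ≤ 2) :
    HasSubgaussianMGF Y (Real.toNNReal (16 * t ^ 2)) μ := by
  have h2 : ∫⁻ ω, ENNReal.ofReal (Real.exp (Y ω ^ 2 / t ^ 2)) ∂μ ≤ ENNReal.ofReal 2 := by
    simpa using h
  have hint := integrable_exp_of_lintegral_le (by fun_prop) h2
  have hle := integral_exp_le_of_lintegral_le (by fun_prop) zero_le_two h2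
  have hhalf : ∀ y : ℝ, Real.exp (y ^ 2 / (2 * t ^ 2)) ≤ Real.exp (y ^ 2 / t ^ 2) := fun y => by
    gcongr
    linarith [sq_nonneg t]
  have hyoung : ∀ s y : ℝ, |s * y| ≤ s ^ 2 * t ^ 2 / 2 + y ^ 2 / (2 * t ^ 2) := fun s y => by
    have : s ^ 2 * t ^ 2 / 2 + y ^ 2 / (2 * t ^ 2) - |s * y| = (|s| * t - |y| / t) ^ 2 / 2 := by
      rw [abs_mul, ← sq_abs s, ← sq_abs y]
      field_simp
      ring
    have h' : 0 ≤ (|s| * t - |y| / t) ^ 2 / 2 := by positivity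
    linarith
  have hbig : ∀ s y : ℝ,
      Real.exp (s * y) ≤ Real.exp (s ^ 2 * t ^ 2 / 2) * Real.exp (y ^ 2 / t ^ 2) := fun s y => by
    refine le_trans ?_ (mul_le_mul_of_nonneg_left (hhalf y) (Real.exp_pos _).le)
    rw [← Real.exp_add]
    exact Real.exp_le_exp.2 ((le_abs_self _).trans (hyoung s y))
  have hints : ∀ s : ℝ, Integrable (fun ω => Real.exp (s * Y ω)) μ := fun s =>
    (hint.const_mul (Real.exp (s ^ 2 * t ^ 2 / 2))).mono' (by fun_prop)
      (Eventually.of_forall fun ω => by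
        rw [Real.norm_eq_abs, Real.abs_exp]; exact hbig s (Y ω))
  refine ⟨hints, fun s => ?_⟩
  rw [Real.coe_toNNReal _ (by positivity)]
  -- For small `s`, centering kills the linear Taylor term and leaves `1 + 8 s² t² ≤ exp (16 t² s² /
  -- 2)`. For large `s`, Young's inequality suffices, since the factor `2` is at most `exp (s² t²)`.
  rcases le_total (s ^ 2 * t ^ 2) 1 with hs | hs
  · have hpt : ∀ y : ℝ, Real.exp (s * y) ≤
        1 + s * y + s ^ 2 * (4 * t ^ 2) * Real.exp (y ^ 2 / t ^ 2) := fun y => by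
      refine (exp_le_one_add_add_sq_mul_exp_abs (s * y)).trans ?_
      have e1 : Real.exp |s * y| ≤ 2 * Real.exp (y ^ 2 / (2 * t ^ 2)) := by
        calc Real.exp |s * y| ≤ Real.exp (1 / 2 + y ^ 2 / (2 * t ^ 2)) :=
              Real.exp_le_exp.2 ((hyoung s y).trans (by linarith))
          _ = Real.exp (1 / 2) * Real.exp (y ^ 2 / (2 * t ^ 2)) := Real.exp_add _ _
          _ ≤ _ := by
            refine mul_le_mul_of_nonneg_right ?_ (Real.exp_pos _).le
            have h1 : Real.exp (1 / 2) ^ 2 = Real.exp 1 := by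
              rw [← Real.exp_nat_mul]; norm_num
            nlinarith [Real.exp_one_lt_d9, Real.exp_pos (1 / 2)]
      have e2 : y ^ 2 ≤ 2 * t ^ 2 * Real.exp (y ^ 2 / (2 * t ^ 2)) := by
        have := Real.add_one_le_exp (y ^ 2 / (2 * t ^ 2))
        have h3 : 2 * t ^ 2 * (y ^ 2 / (2 * t ^ 2)) = y ^ 2 := by field_simp
        nlinarith [sq_nonneg t]
      have e3 : Real.exp (y ^ 2 / t ^ 2) =
          Real.exp (y ^ 2 / (2 * t ^ 2)) * Real.exp (y ^ 2 / (2 * t ^ 2)) := by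
        rw [← Real.exp_add]; congr 1; field_simp; ring
      have : (s * y) ^ 2 * Real.exp |s * y| ≤
          s ^ 2 * (2 * t ^ 2 * Real.exp (y ^ 2 / (2 * t ^ 2))) *
            (2 * Real.exp (y ^ 2 / (2 * t ^ 2))) := by
        rw [mul_pow]
        gcongr
      rw [e3]
      linarith
    have hm : mgf Y μ s ≤ 1 + s ^ 2 * (4 * t ^ 2) * 2 := by
      calc mgf Y μ s ≤ ∫ ω, (1 + s * Y ω + s ^ 2 * (4 * t ^ 2) * Real.exp (Y ω ^ 2 / t ^ 2)) ∂μ :=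
            integral_mono (hints s) (((integrable_const _).add (hi.const_mul _)).add
              (hint.const_mul _)) fun ω => hpt (Y ω)
        _ = 1 + s ^ 2 * (4 * t ^ 2) * ∫ ω, Real.exp (Y ω ^ 2 / t ^ 2) ∂μ := by
            rw [integral_one_add_mul_add_mul hi hint, h0]
            simp
        _ ≤ _ := by gcongr
    refine hm.trans (le_trans ?_ (Real.add_one_le_exp _))
    linarith
  · calc mgf Y μ s ≤ ∫ ω, Real.exp (s ^ 2 * t ^ 2 / 2) * Real.exp (Y ω ^ 2 / t ^ 2) ∂μ :=
          integral_mono (hints s) (hint.const_mul _) fun ω => hbig s (Y ω)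
      _ ≤ Real.exp (s ^ 2 * t ^ 2 / 2) * 2 := by
          rw [integral_const_mul]; gcongr
      _ ≤ Real.exp (s ^ 2 * t ^ 2 / 2) * Real.exp (s ^ 2 * t ^ 2) := by
          gcongr
          linarith [Real.add_one_le_exp (s ^ 2 * t ^ 2)]
      _ ≤ _ := by
          rw [← Real.exp_add]
          gcongr
          nlinarith

/-- Squares of subgaussian variables have a uniformly bounded exponential moment. -/
theorem exists_lintegral_exp_sq_le (c : NNReal) :
    ∃ a B : ℝ, 0 < a ∧ 0 ≤ B ∧ ∀ (Y : Ω → ℝ) (c' : NNReal), Measurable Y → c' ≤ c →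
      HasSubgaussianMGF Y c' μ →
      ∫⁻ ω, ENNReal.ofReal (Real.exp (a * Y ω ^ 2)) ∂μ ≤ ENNReal.ofReal B := by
  obtain ⟨C, hC, hCi⟩ := IsGaussian.exists_integrable_exp_sq (gaussianReal 0 1)
  -- This gives `c' * a ≤ C`, so after averaging over `Y` the Gaussian integrand below is dominated
  -- by `exp (C g²)`. The `+ 1` covers `c = 0`.
  let a : ℝ := C / (c + 1)
  have ha : 0 < a := by positivity
  refine ⟨a, ∫ g, Real.exp (C * ‖g‖ ^ 2) ∂gaussianReal 0 1, ha,
    integral_nonneg fun g => (Real.exp_pos _).le, fun Y c' hY hc hsub => ?_⟩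
  let b := Real.sqrt (2 * a)
  have hb : b ^ 2 = 2 * a := Real.sq_sqrt (by positivity)
  -- Gaussian linearization: `exp (a y²) = E exp (b y g)` for standard normal `g` and `b² = 2a`.
  -- Swapping the integrals leaves only the mgf of `Y`.
  have hrep : ∀ y : ℝ, ENNReal.ofReal (Real.exp (a * y ^ 2)) =
      ∫⁻ g, ENNReal.ofReal (Real.exp (b * y * g)) ∂gaussianReal 0 1 := fun y => by
    have hm := congrFun (mgf_id_gaussianReal (μ := 0) (v := 1)) (b * y)
    have hi : Integrable (fun g => Real.exp (b * y * g)) (gaussianReal 0 1) :=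
      integrable_exp_mul_gaussianReal (b * y)
    rw [← ofReal_integral_eq_lintegral_ofReal hi
      (Eventually.of_forall fun g => (Real.exp_pos _).le)]
    congr 1
    simp only [mgf, id] at hm
    rw [hm, mul_pow, hb]
    congr 1
    simp
    ring
  simp_rw [hrep]
  rw [lintegral_lintegral_swap (by fun_prop)]
  rw [ofReal_integral_eq_lintegral_ofReal hCi
      (Eventually.of_forall fun g => (Real.exp_pos _).le)]
  refine lintegral_mono fun g => ?_
  have hint : Integrable (fun ω => Real.exp (b * Y ω * g)) μ := by
    simpa [mul_comm, mul_assoc, mul_left_comm] using hsub.integrable_exp_mul (b * g)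
  rw [← ofReal_integral_eq_lintegral_ofReal hint
      (Eventually.of_forall fun g => (Real.exp_pos _).le)]
  refine ENNReal.ofReal_le_ofReal ?_
  have hm := hsub.mgf_le (b * g)
  have he : ∫ ω, Real.exp (b * Y ω * g) ∂μ = mgf Y μ (b * g) := by
    simp only [mgf]; congr 1; ext ω; congr 1; ring
  rw [he]
  refine hm.trans (Real.exp_le_exp.2 ?_)
  rw [mul_pow, hb, Real.norm_eq_abs, sq_abs]
  have hc' : (c' : ℝ) ≤ c := by exact_mod_cast hc
  have h1 : (c' : ℝ) * a ≤ C := by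
    calc (c' : ℝ) * a ≤ (c + 1) * a := by gcongr; linarith
      _ = C := by simp only [a]; field_simp
  nlinarith [sq_nonneg g]

/-- Bernstein's bound on the mgf of a centered square. -/
theorem mgf_sq_sub_le {a B v : ℝ} (ha : 0 < a) (hB : 0 ≤ B) {Y : Ω → ℝ} (hY : Measurable Y)
    (h : ∫⁻ ω, ENNReal.ofReal (Real.exp (a * Y ω ^ 2)) ∂μ ≤ ENNReal.ofReal B)
    (hi : Integrable (fun ω => Y ω ^ 2) μ) (hv : ∫ ω, Y ω ^ 2 ∂μ = v) (hv0 : 0 ≤ v) (hv1 : v ≤ 1)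
    {s : ℝ} (hs : |s| ≤ a / 2) :
    Integrable (fun ω => Real.exp (s * (Y ω ^ 2 - v))) μ ∧
      mgf (fun ω => Y ω ^ 2 - v) μ s ≤ Real.exp (8 / a ^ 2 * Real.exp a * B * s ^ 2) := by
  have hint := integrable_exp_of_lintegral_le (by fun_prop) h
  have hle := integral_exp_le_of_lintegral_le (by fun_prop) hB h
  have habs : ∀ y : ℝ, |s * (y ^ 2 - v)| ≤ a / 2 * (y ^ 2 + 1) := fun y => by
    rw [abs_mul]
    refine mul_le_mul hs (abs_le.2 ⟨?_, ?_⟩) (abs_nonneg _) (by positivity) <;>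
      nlinarith [sq_nonneg y]
  have hexp : ∀ y : ℝ, Real.exp (a / 2 * (y ^ 2 + 1)) * Real.exp (a / 2 * (y ^ 2 + 1)) =
      Real.exp a * Real.exp (a * y ^ 2) := fun y => by
    rw [← Real.exp_add, ← Real.exp_add]; congr 1; ring
  have hone : ∀ y : ℝ, 1 ≤ Real.exp (a / 2 * (y ^ 2 + 1)) := fun y =>
    Real.one_le_exp (by positivity)
  have hints : Integrable (fun ω => Real.exp (s * (Y ω ^ 2 - v))) μ :=
    (hint.const_mul (Real.exp a)).mono' (by fun_prop) (Eventually.of_forall fun ω => by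
      rw [Real.norm_eq_abs, Real.abs_exp, ← hexp]
      calc _ ≤ Real.exp (a / 2 * (Y ω ^ 2 + 1)) :=
            Real.exp_le_exp.2 ((le_abs_self _).trans (habs _))
        _ ≤ _ := le_mul_of_one_le_left (Real.exp_pos _).le (hone _))
  refine ⟨hints, ?_⟩
  -- Second-order Taylor bound; the factors `(y² - v)²` and `exp |s (y² - v)|` each consume one copy
  -- of `exp (a (y² + 1) / 2)`.
  have hpt : ∀ y : ℝ, Real.exp (s * (y ^ 2 - v)) ≤
      1 + s * (y ^ 2 - v) + 8 / a ^ 2 * s ^ 2 * Real.exp a * Real.exp (a * y ^ 2) := fun y => by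
    refine (exp_le_one_add_add_sq_mul_exp_abs _).trans ?_
    have e1 : Real.exp |s * (y ^ 2 - v)| ≤ Real.exp (a / 2 * (y ^ 2 + 1)) :=
      Real.exp_le_exp.2 (habs y)
    have e2 : (y ^ 2 - v) ^ 2 ≤ 8 / a ^ 2 * Real.exp (a / 2 * (y ^ 2 + 1)) := by
      have hq := Real.quadratic_le_exp_of_nonneg (x := a / 2 * (y ^ 2 + 1)) (by positivity)
      have h3 : (y ^ 2 - v) ^ 2 ≤ (y ^ 2 + 1) ^ 2 :=
        sq_le_sq' (by nlinarith [sq_nonneg y]) (by linarith)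
      have h4 : (a / 2 * (y ^ 2 + 1)) ^ 2 / 2 ≤ Real.exp (a / 2 * (y ^ 2 + 1)) := by
        have : 0 ≤ a / 2 * (y ^ 2 + 1) := by positivity
        linarith
      calc (y ^ 2 - v) ^ 2 ≤ (y ^ 2 + 1) ^ 2 := h3
        _ = 8 / a ^ 2 * ((a / 2 * (y ^ 2 + 1)) ^ 2 / 2) := by field_simp; ring
        _ ≤ _ := by gcongr
    have : (s * (y ^ 2 - v)) ^ 2 * Real.exp |s * (y ^ 2 - v)| ≤
        s ^ 2 * (8 / a ^ 2 * Real.exp (a / 2 * (y ^ 2 + 1))) *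
          Real.exp (a / 2 * (y ^ 2 + 1)) := by
      rw [mul_pow]
      gcongr
    have h5 := hexp y
    calc _ ≤ 1 + s * (y ^ 2 - v) + s ^ 2 * (8 / a ^ 2 * Real.exp (a / 2 * (y ^ 2 + 1))) *
          Real.exp (a / 2 * (y ^ 2 + 1)) := by linarith
      _ = 1 + s * (y ^ 2 - v) + 8 / a ^ 2 * s ^ 2 * (Real.exp (a / 2 * (y ^ 2 + 1)) *
          Real.exp (a / 2 * (y ^ 2 + 1))) := by ring
      _ = _ := by rw [h5]; ring
  have hc : Integrable (fun ω => Y ω ^ 2 - v) μ := hi.sub (integrable_const _)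
  have hm : mgf (fun ω => Y ω ^ 2 - v) μ s ≤ 1 + 8 / a ^ 2 * s ^ 2 * Real.exp a * B := by
    calc mgf (fun ω => Y ω ^ 2 - v) μ s
        ≤ ∫ ω, (1 + s * (Y ω ^ 2 - v) +
            8 / a ^ 2 * s ^ 2 * Real.exp a * Real.exp (a * Y ω ^ 2)) ∂μ :=
          integral_mono hints (((integrable_const _).add (hc.const_mul _)).add
            (hint.const_mul _)) fun ω => hpt (Y ω)
      _ = 1 + 8 / a ^ 2 * s ^ 2 * Real.exp a * ∫ ω, Real.exp (a * Y ω ^ 2) ∂μ := by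
          rw [integral_one_add_mul_add_mul hc hint, integral_sub hi (integrable_const _), hv]
          simp
      _ ≤ _ := by gcongr
  refine hm.trans (le_trans (le_of_eq ?_) (Real.add_one_le_exp _))
  ring

end Subgaussian

/-! ### Nets and quadratic forms -/

section Net

variable {E F : Type*} [NormedAddCommGroup E] [InnerProductSpace ℝ E]
  [NormedAddCommGroup F] [InnerProductSpace ℝ F]

/-- The unit ball of a `d`-dimensional space has a `1/2`-net with at most `5 ^ d` points. -/
theorem exists_half_net (E : Type*) [NormedAddCommGroup E] [InnerProductSpace ℝ E]
    [FiniteDimensional ℝ E] : ∃ S : Finset E, S.card ≤ 5 ^ Module.finrank ℝ E ∧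
    (∀ x ∈ S, ‖x‖ ≤ 1) ∧ ∀ x : E, ‖x‖ ≤ 1 → ∃ y ∈ S, ‖x - y‖ ≤ 1 / 2 := by
  classical
  -- A `1/2`-separated subset of the unit ball of maximal cardinality is a net. Scaling by `2`
  -- matches the Besicovitch bound for `1`-separated points in the ball of radius `2`.
  let P : Finset E → Prop := fun S =>
    (∀ x ∈ S, ‖x‖ ≤ 1) ∧ ∀ x ∈ S, ∀ y ∈ S, x ≠ y → 1 / 2 ≤ ‖x - y‖
  have hcard : ∀ S, P S → S.card ≤ 5 ^ Module.finrank ℝ E := fun S hS => by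
    have hinj : Function.Injective fun x : E => (2 : ℝ) • x :=
      smul_right_injective E two_ne_zero
    rw [← Finset.card_image_of_injective S hinj]
    refine Besicovitch.card_le_of_separated _ ?_ ?_
    · simp only [Finset.mem_image]
      rintro _ ⟨x, hx, rfl⟩
      rw [norm_smul, Real.norm_two]
      linarith [hS.1 x hx]
    · simp only [Finset.mem_image]
      rintro _ ⟨x, hx, rfl⟩ _ ⟨y, hy, rfl⟩ hxy
      rw [← smul_sub, norm_smul, Real.norm_two]
      linarith [hS.2 x hx y hy fun h => hxy (by rw [h])]
  let Q : ℕ → Prop := fun m => ∃ S, P S ∧ S.card = m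
  have hQ : ∃ m, Q m ∧ ∀ m', Q m' → m' ≤ m := by
    refine ⟨Nat.findGreatest Q (5 ^ Module.finrank ℝ E),
      Nat.findGreatest_spec (P := Q) (Nat.zero_le _) ⟨∅, by simp [P], rfl⟩, ?_⟩
    rintro m' ⟨S, hS, rfl⟩
    exact Nat.le_findGreatest (hcard S hS) ⟨S, hS, rfl⟩
  obtain ⟨_, ⟨S, hS, rfl⟩, hmax⟩ := hQ
  refine ⟨S, hcard S hS, hS.1, fun x hx => ?_⟩
  by_contra! hfar
  have hxS : x ∉ S := fun h => by
    have := hfar x h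
    simp only [sub_self, norm_zero] at this
    linarith
  have := hmax _ ⟨insert x S, ⟨?_, ?_⟩, rfl⟩
  · rw [Finset.card_insert_of_notMem hxS] at this
    omega
  · simp only [Finset.mem_insert]
    rintro y (rfl | hy)
    exacts [hx, hS.1 y hy]
  · simp only [Finset.mem_insert]
    rintro y (rfl | hy) z (rfl | hz) hyz
    · exact absurd rfl hyz
    · exact (hfar z hz).le
    · rw [norm_sub_rev]; exact (hfar y hy).le
    · exact hS.2 y hy z hz hyz

/-- Replacing a unit vector by a net point costs at most `‖A‖ / 2`, which is absorbed on the left.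
-/
theorem norm_le_of_half_net {S : Finset E}
    (hS : ∀ x : E, ‖x‖ ≤ 1 → ∃ y ∈ S, ‖x - y‖ ≤ 1 / 2) {G : Type*} [SeminormedAddCommGroup G]
    [NormedSpace ℝ G] (A : E →L[ℝ] G) {c : ℝ} (hc : 0 ≤ c) (h : ∀ y ∈ S, ‖A y‖ ≤ c) :
    ‖A‖ ≤ 2 * c := by
  have : ‖A‖ ≤ c + ‖A‖ / 2 := by
    refine A.opNorm_le_of_unit_norm (by positivity) fun x hx => ?_
    obtain ⟨y, hy, hxy⟩ := hS x hx.le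
    calc ‖A x‖ = ‖A y + A (x - y)‖ := by rw [← map_add]; congr 2; abel
      _ ≤ ‖A y‖ + ‖A (x - y)‖ := norm_add_le _ _
      _ ≤ c + ‖A‖ * (1 / 2) := add_le_add (h y hy) ((A.le_opNorm _).trans (by gcongr))
      _ = _ := by ring
  linarith

/-- A quadratic form `‖T x‖² - r ‖x‖²` is controlled by its values at half sums and half
differences of points of a `1/2`-net. -/
theorem abs_quadForm_le_of_half_net {S : Finset E}
    (hS : ∀ x : E, ‖x‖ ≤ 1 → ∃ y ∈ S, ‖x - y‖ ≤ 1 / 2) (T : E →L[ℝ] F) (r : ℝ) {δ : ℝ}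
    (hδ : 0 ≤ δ)
    (h1 : ∀ x ∈ S, ∀ y ∈ S,
      |‖T ((1 / 2 : ℝ) • (x + y))‖ ^ 2 - r * ‖(1 / 2 : ℝ) • (x + y)‖ ^ 2| ≤ δ)
    (h2 : ∀ x ∈ S, ∀ y ∈ S,
      |‖T ((1 / 2 : ℝ) • (x - y))‖ ^ 2 - r * ‖(1 / 2 : ℝ) • (x - y)‖ ^ 2| ≤ δ) (x : E) :
    |‖T x‖ ^ 2 - r * ‖x‖ ^ 2| ≤ 8 * δ * ‖x‖ ^ 2 := by
  let B : E →L[ℝ] E →L[ℝ] ℝ := (innerSL ℝ).bilinearComp T T - r • innerSL ℝ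
  have hB : ∀ x y, B x y = inner ℝ (T x) (T y) - r * inner ℝ x y := fun x y => by
    simp only [B, sub_apply, smul_apply]
    rfl
  have hSB : ∀ x ∈ S, ∀ y ∈ S, ‖B x y‖ ≤ 2 * δ := fun x hx y hy => by
    -- Polarization: half sums and half differences keep the test vectors in the unit ball when `x`
    -- and `y` are.
    have hpol : B x y =
        (‖T ((1 / 2 : ℝ) • (x + y))‖ ^ 2 - r * ‖(1 / 2 : ℝ) • (x + y)‖ ^ 2) -
        (‖T ((1 / 2 : ℝ) • (x - y))‖ ^ 2 - r * ‖(1 / 2 : ℝ) • (x - y)‖ ^ 2) := by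
      rw [hB]
      simp only [map_smul, map_add, map_sub, norm_smul, mul_pow, norm_add_sq_real,
        norm_sub_sq_real]
      norm_num
      ring
    rw [hpol, Real.norm_eq_abs]
    refine (abs_sub _ _).trans ?_
    linarith [h1 x hx y hy, h2 x hx y hy]
  -- The net argument is used once per argument of `B`; with the `2 * δ` from polarization this
  -- produces the factor `8`.
  have hB1 : ∀ x ∈ S, ‖B x‖ ≤ 2 * (2 * δ) := fun x hx =>
    norm_le_of_half_net hS (B x) (by positivity) (hSB x hx)
  have hB2 : ‖B‖ ≤ 2 * (2 * (2 * δ)) := norm_le_of_half_net hS B (by positivity) hB1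
  have := B.le_opNorm₂ x x
  rw [hB, real_inner_self_eq_norm_sq, real_inner_self_eq_norm_sq, Real.norm_eq_abs] at this
  refine this.trans ?_
  rw [mul_assoc, ← sq]
  gcongr
  linarith

end Net

/-! ### Uniform concentration and Borel–Cantelli -/

section Concentration

variable {Ω : Type*} [MeasurableSpace Ω] {μ : Measure Ω}

/-- An array of independent standardized subgaussian random variables. -/
structure IsSubgaussianArray (μ : Measure Ω) (c : NNReal) {ι κ : Type*} (z : ι × κ → Ω → ℝ) :
    Prop where
  measurable : ∀ p, Measurable (z p)
  indep : iIndepFun z μ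
  mean : ∀ p, ∫ ω, z p ω ∂μ = 0
  second_moment : ∀ p, ∫ ω, z p ω ^ 2 ∂μ = 1
  subgaussian : ∀ p, HasSubgaussianMGF (z p) c μ

theorem IsSubgaussianArray.precomp {c : NNReal} {ι ι' κ : Type*} {z : ι × κ → Ω → ℝ}
    (hz : IsSubgaussianArray μ c z) {f : ι' → ι} (hf : Function.Injective f) :
    IsSubgaussianArray μ c fun p : ι' × κ => z (f p.1, p.2) where
  measurable p := hz.measurable _
  indep := hz.indep.precomp (g := fun p : ι' × κ => (f p.1, p.2)) fun p q h => by
    rw [Prod.mk.injEq] at h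
    exact Prod.ext (hf h.1) h.2
  mean p := hz.mean _
  second_moment p := hz.second_moment _
  subgaussian p := hz.subgaussian _

variable {c : NNReal} {ι κ : Type*} [Fintype ι] {z : ι × κ → Ω → ℝ}

/-- By independence the parameters add to `c * ‖x‖²`. Allowing any `c' ≤ c` keeps later constants
independent of `x` and of the dimension. -/
theorem IsSubgaussianArray.hasSubgaussianMGF_sum (hz : IsSubgaussianArray μ c z)
    (x : EuclideanSpace ℝ ι) (hx : ‖x‖ ≤ 1) (j : κ) :
    ∃ c' ≤ c, HasSubgaussianMGF (fun ω => ∑ i, x i * z (i, j) ω) c' μ := by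
  have hind : iIndepFun (fun i ω => x i * z (i, j) ω) μ :=
    (hz.indep.precomp (g := fun i => (i, j)) (Prod.mk_left_injective j)).comp
      (fun i y => x i * y) fun i => by fun_prop
  refine ⟨_, ?_, HasSubgaussianMGF.sum_of_iIndepFun hind
    fun i _ => (hz.subgaussian (i, j)).const_mul (x i)⟩
  rw [← NNReal.coe_le_coe]
  rw [NNReal.coe_sum]
  change ∑ i, x i ^ 2 * (c : ℝ) ≤ c
  rw [← Finset.sum_mul]
  have : ∑ i, x i ^ 2 ≤ 1 := by
    rw [← EuclideanSpace.real_norm_sq_eq]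
    exact pow_le_one₀ (norm_nonneg _) hx
  exact mul_le_of_le_one_left c.2 this

theorem IsSubgaussianArray.integral_sum_sq [IsProbabilityMeasure μ] (hz : IsSubgaussianArray μ c z)
    (x : EuclideanSpace ℝ ι) (j : κ) :
    Integrable (fun ω => (∑ i, x i * z (i, j) ω) ^ 2) μ ∧
      ∫ ω, (∑ i, x i * z (i, j) ω) ^ 2 ∂μ = ‖x‖ ^ 2 := by
  have hind : iIndepFun (fun i ω => x i * z (i, j) ω) μ :=
    (hz.indep.precomp (g := fun i => (i, j)) (Prod.mk_left_injective j)).comp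
      (fun i y => x i * y) fun i => by fun_prop
  have hL : ∀ i, MemLp (z (i, j)) 2 μ := fun i => by
    simpa using (hz.subgaussian (i, j)).memLp 2
  have hLx : ∀ i, MemLp (fun ω => x i * z (i, j) ω) 2 μ := fun i => (hL i).const_mul _
  have hsum : MemLp (fun ω => ∑ i, x i * z (i, j) ω) 2 μ := memLp_finsetSum _ fun i _ => hLx i
  refine ⟨hsum.integrable_sq, ?_⟩
  have h0 : ∫ ω, ∑ i, x i * z (i, j) ω ∂μ = 0 := by
    rw [integral_finsetSum _ fun i _ => (hLx i).integrable one_le_two]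
    simp [integral_const_mul, hz.mean]
  have hv := IndepFun.variance_sum (s := Finset.univ) (fun i _ => hLx i)
    fun i _ i' _ hii => hind.indepFun hii
  have hfun : (∑ i, fun ω => x i * z (i, j) ω) = fun ω => ∑ i, x i * z (i, j) ω := by
    ext ω; simp
  rw [hfun, variance_of_integral_eq_zero hsum.aemeasurable h0] at hv
  rw [hv, EuclideanSpace.real_norm_sq_eq]
  refine Finset.sum_congr rfl fun i _ => ?_
  rw [variance_const_mul, variance_of_integral_eq_zero (hz.measurable _).aemeasurable (hz.mean _),
    hz.second_moment, mul_one]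

/-- Bernstein's inequality for `∑ⱼ (∑ᵢ xᵢ zᵢⱼ)²`. -/
theorem exists_measure_quadForm_le (μ : Measure Ω) [IsProbabilityMeasure μ] (c : NNReal) :
    ∃ a C : ℝ, 0 < a ∧ 0 ≤ C ∧ ∀ (ι κ : Type) [Fintype ι] [Fintype κ] (z : ι × κ → Ω → ℝ),
      IsSubgaussianArray μ c z → ∀ x : EuclideanSpace ℝ ι, ‖x‖ ≤ 1 → ∀ s δ : ℝ, 0 ≤ s → s ≤ a →
      μ.real {ω | Fintype.card κ * δ ≤
          |∑ j, (∑ i, x i * z (i, j) ω) ^ 2 - Fintype.card κ * ‖x‖ ^ 2|} ≤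
        2 * Real.exp (-(Fintype.card κ * (s * δ - C * s ^ 2))) := by
  obtain ⟨a, B, ha, hB, hab⟩ := exists_lintegral_exp_sq_le (μ := μ) c
  refine ⟨a / 2, 8 / a ^ 2 * Real.exp a * B, by positivity, by positivity, ?_⟩
  intro ι κ _ _ z hz x hx s δ hs0 hsa
  set C := 8 / a ^ 2 * Real.exp a * B
  set m : ℝ := ((Fintype.card κ : ℕ) : ℝ)
  let Y : κ → Ω → ℝ := fun j ω => ∑ i, x i * z (i, j) ω
  let W : κ → Ω → ℝ := fun j ω => Y j ω ^ 2 - ‖x‖ ^ 2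
  have hYm : ∀ j, Measurable (Y j) := fun j =>
    Finset.measurable_fun_sum _ fun i _ => (hz.measurable _).const_mul _
  have hWm : ∀ j, Measurable (W j) := fun j => ((hYm j).pow_const 2).sub_const _
  have hmgf : ∀ t : ℝ, |t| ≤ a / 2 → ∀ j,
      Integrable (fun ω => Real.exp (t * W j ω)) μ ∧
        mgf (W j) μ t ≤ Real.exp (C * t ^ 2) := fun t ht j => by
    obtain ⟨c', hc', hsub⟩ := hz.hasSubgaussianMGF_sum x hx j
    obtain ⟨hi, hv⟩ := hz.integral_sum_sq x j
    exact mgf_sq_sub_le ha hB (hYm j) (hab _ c' (hYm j) hc' hsub) hi hv (sq_nonneg _)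
      (pow_le_one₀ (norm_nonneg _) hx) ht
  -- Each `W j` depends only on column `j`, so the index pair is swapped to make columns the
  -- independent blocks.
  have hindW : iIndepFun W μ := by
    have hsw : iIndepFun (fun p : κ × ι => z (p.2, p.1)) μ :=
      hz.indep.precomp (g := fun p : κ × ι => (p.2, p.1)) Prod.swap_injective
    exact (iIndepFun_curry (fun p => hz.measurable _) hsw).comp
      (fun _ y => (∑ i, x i * y i) ^ 2 - ‖x‖ ^ 2) fun _ => by fun_prop
  have hsum : ∀ ω, ∑ j, Y j ω ^ 2 - m * ‖x‖ ^ 2 = (∑ j, W j) ω := fun ω => by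
    simp [W, m, Finset.sum_sub_distrib]
  have hmgfsum : ∀ t : ℝ, |t| ≤ a / 2 → mgf (∑ j, W j) μ t ≤ Real.exp (m * (C * t ^ 2)) :=
    fun t ht => by
      rw [hindW.mgf_sum hWm]
      calc ∏ j, mgf (W j) μ t ≤ ∏ _j : κ, Real.exp (C * t ^ 2) :=
            Finset.prod_le_prod (fun _ _ => mgf_nonneg) fun j _ => (hmgf t ht j).2
        _ = _ := by
          rw [Finset.prod_const, ← Real.exp_nat_mul, Finset.card_univ]
  have hintsum : ∀ t : ℝ, |t| ≤ a / 2 →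
      Integrable (fun ω => Real.exp (t * (∑ j, W j) ω)) μ := fun t ht =>
    hindW.integrable_exp_mul_sum hWm fun j _ => (hmgf t ht j).1
  have hs' : |s| ≤ a / 2 := by rwa [abs_of_nonneg hs0]
  have hsn : |-s| ≤ a / 2 := by rwa [abs_neg]
  have hup := measure_ge_le_exp_mul_mgf (m * δ) hs0 (hintsum s hs')
  have hlo := measure_le_le_exp_mul_mgf (-(m * δ)) (neg_nonpos.2 hs0) (hintsum (-s) hsn)
  have hbound : ∀ t : ℝ, |t| ≤ a / 2 → t ^ 2 = s ^ 2 →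
      Real.exp (-s * (m * δ)) * mgf (∑ j, W j) μ t ≤ Real.exp (-(m * (s * δ - C * s ^ 2))) :=
    fun t ht hts => by
      refine (mul_le_mul_of_nonneg_left (hmgfsum t ht) (Real.exp_pos _).le).trans (le_of_eq ?_)
      rw [← Real.exp_add, hts]
      congr 1
      ring
  have hset : {ω | m * δ ≤ |∑ j, Y j ω ^ 2 - m * ‖x‖ ^ 2|} ⊆
      {ω | m * δ ≤ (∑ j, W j) ω} ∪ {ω | (∑ j, W j) ω ≤ -(m * δ)} := fun ω hω => by
    simp only [Set.mem_ofPred_eq, hsum] at hω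
    rcases le_abs.1 hω with h | h
    · exact Or.inl h
    · exact Or.inr (le_neg.1 h)
  refine (measureReal_mono hset).trans ((measureReal_union_le _ _).trans ?_)
  have h1 := hup.trans (hbound s hs' rfl)
  have h2 := hlo.trans (le_trans (le_of_eq (by ring_nf)) (hbound (-s) hsn (by ring)))
  linarith

/-- Uniform version of `exists_measure_quadForm_le` over all `x`. -/
theorem exists_measure_exists_quadForm_le (μ : Measure Ω) [IsProbabilityMeasure μ] (c : NNReal) :
    ∃ a C : ℝ, 0 < a ∧ 0 ≤ C ∧ ∀ (ι κ : Type) [Fintype ι] [Fintype κ] (z : ι × κ → Ω → ℝ),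
      IsSubgaussianArray μ c z → ∀ s δ : ℝ, 0 ≤ s → s ≤ a → 0 ≤ δ →
      μ.real {ω | ∃ x : EuclideanSpace ℝ ι, 8 * δ * (Fintype.card κ * ‖x‖ ^ 2) <
          |∑ j, (∑ i, x i * z (i, j) ω) ^ 2 - Fintype.card κ * ‖x‖ ^ 2|} ≤
        4 * (25 ^ Fintype.card ι * Real.exp (-(Fintype.card κ * (s * δ - C * s ^ 2)))) := by
  classical
  obtain ⟨a, C, ha, hC, hP⟩ := exists_measure_quadForm_le μ c
  refine ⟨a, C, ha, hC, ?_⟩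
  intro ι κ _ _ z hz s δ hs0 hsa hδ
  set m : ℝ := ((Fintype.card κ : ℕ) : ℝ)
  set p := 2 * Real.exp (-(m * (s * δ - C * s ^ 2)))
  obtain ⟨S, hcard, hS1, hnet⟩ := exists_half_net (EuclideanSpace ℝ ι)
  rw [finrank_euclideanSpace] at hcard
  let bad : EuclideanSpace ℝ ι → Set Ω := fun x =>
    {ω | m * δ ≤ |∑ j, (∑ i, x i * z (i, j) ω) ^ 2 - m * ‖x‖ ^ 2|}
  let add' : EuclideanSpace ℝ ι × EuclideanSpace ℝ ι → EuclideanSpace ℝ ι :=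
    fun q => (1 / 2 : ℝ) • (q.1 + q.2)
  let sub' : EuclideanSpace ℝ ι × EuclideanSpace ℝ ι → EuclideanSpace ℝ ι :=
    fun q => (1 / 2 : ℝ) • (q.1 - q.2)
  have hset : {ω | ∃ x : EuclideanSpace ℝ ι, 8 * δ * (m * ‖x‖ ^ 2) <
      |∑ j, (∑ i, x i * z (i, j) ω) ^ 2 - m * ‖x‖ ^ 2|} ⊆
      ⋃ q ∈ S ×ˢ S, (bad (add' q) ∪ bad (sub' q)) := by
    intro ω hω
    by_contra hn
    simp only [Set.mem_iUnion, Set.mem_union, not_exists, not_or, bad, Set.mem_ofPred_eq,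
      not_le] at hn
    obtain ⟨x, hx⟩ := hω
    let T : EuclideanSpace ℝ ι →L[ℝ] EuclideanSpace ℝ κ :=
      (Matrix.toLpLin 2 2 (Matrix.of fun j i => z (i, j) ω)).toContinuousLinearMap
    have hT : ∀ x, ‖T x‖ ^ 2 = ∑ j, (∑ i, x i * z (i, j) ω) ^ 2 := fun x => by
      rw [EuclideanSpace.real_norm_sq_eq]
      simp [T, Matrix.toLpLin_apply, Matrix.mulVec, dotProduct, mul_comm]
    have hq := abs_quadForm_le_of_half_net hnet T m (δ := m * δ) (by positivity)
      (fun x hx y hy => by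
        rw [hT]; exact (hn (x, y) (Finset.mk_mem_product hx hy)).1.le)
      (fun x hx y hy => by
        rw [hT]; exact (hn (x, y) (Finset.mk_mem_product hx hy)).2.le) x
    rw [hT] at hq
    have : 8 * (m * δ) * ‖x‖ ^ 2 = 8 * δ * (m * ‖x‖ ^ 2) := by ring
    linarith
  refine (measureReal_mono hset (measure_ne_top _ _)).trans
    ((measureReal_biUnion_finset_le _ _).trans ?_)
  have hterm : ∀ q ∈ S ×ˢ S, μ.real (bad (add' q) ∪ bad (sub' q)) ≤ 2 * p := fun q hq => by
    obtain ⟨h1, h2⟩ := Finset.mem_product.1 hq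
    have hn1 := hS1 _ h1
    have hn2 := hS1 _ h2
    have ha' : ‖add' q‖ ≤ 1 := by
      rw [norm_smul, Real.norm_of_nonneg (by norm_num)]
      linarith [norm_add_le q.1 q.2]
    have hs' : ‖sub' q‖ ≤ 1 := by
      rw [norm_smul, Real.norm_of_nonneg (by norm_num)]
      linarith [norm_sub_le q.1 q.2]
    refine (measureReal_union_le _ _).trans ?_
    linarith [hP ι κ z hz _ ha' s δ hs0 hsa, hP ι κ z hz _ hs' s δ hs0 hsa]
  refine (Finset.sum_le_card_nsmul _ _ _ hterm).trans ?_
  rw [Finset.card_product, nsmul_eq_mul]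
  -- The union bound runs over pairs of net points, hence `25 = 5 ^ 2`.
  have hc2 : ((S.card * S.card : ℕ) : ℝ) ≤ 25 ^ Fintype.card ι := by
    have : S.card * S.card ≤ 25 ^ Fintype.card ι := by
      calc S.card * S.card ≤ 5 ^ Fintype.card ι * 5 ^ Fintype.card ι := Nat.mul_le_mul hcard hcard
        _ = 25 ^ Fintype.card ι := by rw [← mul_pow]; norm_num
    exact_mod_cast this
  calc ((S.card * S.card : ℕ) : ℝ) * (2 * p) ≤ 25 ^ Fintype.card ι * (2 * p) := by gcongr
    _ = _ := by simp only [p]; ring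

/-- Almost sure uniform concentration for sequences of arrays, given a large deviation rate that
beats the entropy of the net. -/
theorem ae_eventually_quadForm_le [IsProbabilityMeasure μ] {a C : ℝ}
    (hP : ∀ (ι κ : Type) [Fintype ι] [Fintype κ] (z : ι × κ → Ω → ℝ),
      IsSubgaussianArray μ c z → ∀ s δ : ℝ, 0 ≤ s → s ≤ a → 0 ≤ δ →
      μ.real {ω | ∃ x : EuclideanSpace ℝ ι, 8 * δ * (Fintype.card κ * ‖x‖ ^ 2) <
          |∑ j, (∑ i, x i * z (i, j) ω) ^ 2 - Fintype.card κ * ‖x‖ ^ 2|} ≤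
        4 * (25 ^ Fintype.card ι * Real.exp (-(Fintype.card κ * (s * δ - C * s ^ 2)))))
    {m : ℕ → ℕ} {z : (n : ℕ) → Fin (m n) × Fin n → Ω → ℝ}
    (hz : ∀ n, IsSubgaussianArray μ c (z n)) {s δ η : ℝ} (hs0 : 0 ≤ s) (hsa : s ≤ a)
    (hδ : 0 ≤ δ) (hη : 0 < η)
    (hrate : ∀ᶠ n : ℕ in atTop, m n * Real.log 25 + η * n ≤ n * (s * δ - C * s ^ 2)) :
    ∀ᵐ ω ∂μ, ∀ᶠ n in atTop, ∀ x : EuclideanSpace ℝ (Fin (m n)),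
      |∑ j, (∑ i, x i * z n (i, j) ω) ^ 2 - n * ‖x‖ ^ 2| ≤ 8 * δ * (n * ‖x‖ ^ 2) := by
  obtain ⟨n₀, hn₀⟩ := eventually_atTop.1 hrate
  -- Emptying the events before `n₀` makes the geometric bound hold for every `n`.
  let bad : ℕ → Set Ω := fun n => if n₀ ≤ n then
    {ω | ∃ x : EuclideanSpace ℝ (Fin (m n)), 8 * δ * (n * ‖x‖ ^ 2) <
          |∑ j, (∑ i, x i * z n (i, j) ω) ^ 2 - n * ‖x‖ ^ 2|} else ∅
  have hbad : ∀ n, μ.real (bad n) ≤ 4 * Real.exp (-η) ^ n := fun n => by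
    by_cases hn : n₀ ≤ n
    · simp only [bad, hn, if_true]
      have h := hP _ _ (z n) (hz n) s δ hs0 hsa hδ
      simp only [Fintype.card_fin] at h
      refine h.trans (mul_le_mul_of_nonneg_left ?_ (by norm_num))
      have h25 : (25 : ℝ) ^ m n = Real.exp (m n * Real.log 25) := by
        rw [Real.exp_nat_mul, Real.exp_log (by norm_num)]
      rw [h25, ← Real.exp_add, ← Real.exp_nat_mul]
      refine Real.exp_le_exp.2 ?_
      linarith [hn₀ n hn]
    · simp only [bad, hn, if_false, measureReal_empty]
      positivity
  have hsummable : Summable fun n => μ.real (bad n) :=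
    Summable.of_nonneg_of_le (fun _ => measureReal_nonneg) hbad
      ((summable_geometric_of_lt_one (Real.exp_pos _).le
        (Real.exp_lt_one_iff.2 (neg_lt_zero.2 hη))).mul_left 4)
  have htsum : ∑' n, μ (bad n) ≠ ⊤ := by
    have : (fun n => μ (bad n)) = fun n => ENNReal.ofReal (μ.real (bad n)) := by
      ext n; rw [ofReal_measureReal]
    rw [this]
    exact hsummable.tsum_ofReal_ne_top
  filter_upwards [ae_eventually_notMem htsum] with ω hω
  filter_upwards [hω, eventually_ge_atTop n₀] with n hn hn1 x
  simp only [bad, hn1, if_true, Set.mem_ofPred_eq, not_exists, not_lt] at hn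
  exact hn x

end Concentration

/-! ### Application to the spiked model -/

theorem IsSpikedSample.isSubgaussianArray {Ω : Type*} [MeasurableSpace Ω] {μ : Measure Ω}
    [IsProbabilityMeasure μ] {K : ℝ} (hK : 0 < K) {N M n : ℕ} {U : Matrix (Fin N) (Fin N) ℝ}
    {l : Fin M → ℝ} {Z X : Ω → Matrix (Fin N) (Fin n) ℝ} (h : IsSpikedSample μ K U l Z X) :
    IsSubgaussianArray μ (Real.toNNReal (16 * (2 * K) ^ 2))
      fun (p : Fin N × Fin n) ω => Z ω p.1 p.2 where
  measurable p := h.measurable _ _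
  indep := h.indep
  mean p := h.mean _ _
  second_moment p := h.second_moment _ _
  subgaussian p := by
    -- A nonintegrable square would have Bochner integral `0`, not `1`.
    have hsq : Integrable (fun ω => Z ω p.1 p.2 ^ 2) μ :=
      Integrable.of_integral_ne_zero (by rw [h.second_moment]; exact one_ne_zero)
    have hL : MemLp (fun ω => Z ω p.1 p.2) 2 μ :=
      (memLp_two_iff_integrable_sq (h.measurable _ _).aestronglyMeasurable).2 hsq
    exact hasSubgaussianMGF_of_lintegral_exp_sq_le (by positivity) (h.measurable _ _)
      (hL.integrable one_le_two) (h.mean _ _)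
      (lintegral_exp_sq_le_of_psi2Norm_le hK (h.psi2Norm_le _ _))

theorem gram_eq_sum {N n : ℕ} (Z : Matrix (Fin N) (Fin n) ℝ) (y : Fin N → ℝ) :
    gram Z y = ∑ j, (∑ i, y i * Z i j) ^ 2 := by
  simp [gram, dotProduct, Matrix.mulVec, sq, mul_comm]

theorem gram_eq_sum_of_support {N M n : ℕ} (hM : M ≤ N) (Z : Matrix (Fin N) (Fin n) ℝ)
    {y : Fin N → ℝ} (hy : ∀ i : Fin N, M ≤ (i : ℕ) → y i = 0) :
    gram Z y = ∑ j, (∑ i : Fin M, y (Fin.castLE hM i) * Z (Fin.castLE hM i) j) ^ 2 ∧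
      ∑ i, y i ^ 2 = ∑ i : Fin M, y (Fin.castLE hM i) ^ 2 := by
  have hy' : ∀ i ∉ Set.range (Fin.castLE hM), y i = 0 := fun i hi =>
    hy i (not_lt.1 fun h => hi ⟨⟨i, h⟩, rfl⟩)
  have hinj := Fin.castLE_injective hM
  constructor
  · rw [gram_eq_sum]
    refine Finset.sum_congr rfl fun j _ => ?_
    congr 1
    exact (Fintype.sum_of_injective _ hinj _ _ (fun i hi => by rw [hy' i hi, zero_mul])
      fun i => rfl).symm
  · exact (Fintype.sum_of_injective _ hinj _ _ (fun i hi => by rw [hy' i hi, zero_pow two_ne_zero])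
      fun i => rfl).symm

/-- Since `e ≤ 1`, `(1 + e)² ≤ 1 + 3e`. Half of `ε` pays for `3e`, the other half for the additive
error. -/
theorem abs_div_sub_one_lt {x l e C ε : ℝ} (hl : 0 < l) (he : 0 < e) (he1 : e ≤ 1)
    (heε : 3 * e < ε / 2) (hC : (1 + 1 / e) * C ≤ ε / 2 * l) (hlo : (1 - e) * l ≤ x)
    (hup : x ≤ (1 + e) ^ 2 * l + (1 + 1 / e) * C) : |x / l - 1| < ε := by
  rw [abs_lt]
  constructor
  · have : 1 - e ≤ x / l := (le_div_iff₀ hl).2 hlo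
    linarith
  · have : x / l ≤ (1 + e) ^ 2 + ε / 2 := (div_le_iff₀ hl).2 (by linarith)
    nlinarith

end SpikedCovariance

theorem proposition1
    {Ω : Type*} [MeasurableSpace Ω] (μ : Measure Ω) [IsProbabilityMeasure μ]
    (K γ : ℝ) (hK : 0 < K) (hγ : 0 < γ)
    (N M : ℕ → ℕ)
    (Sigma U : (n : ℕ) → Matrix (Fin (N n)) (Fin (N n)) ℝ)
    (l : (n : ℕ) → Fin (M n) → ℝ)
    (Z X : (n : ℕ) → Ω → Matrix (Fin (N n)) (Fin n) ℝ)
    (hA1 : ∀ n, SpikedCovariance.IsSpikedCovariance (Sigma n) (U n) (l n))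
    (hA2 : ∀ n, SpikedCovariance.IsSpikedSample μ K (U n) (l n) (Z n) (X n))
    (hA3 : ∀ n, 1 ≤ n → 1 / γ ≤ (N n : ℝ) / (n : ℝ) ∧ (N n : ℝ) / (n : ℝ) ≤ γ)
    (hA4 : Tendsto (fun n => (M n : ℝ) / (n : ℝ)) atTop (𝓝 0))
    (ν : (n : ℕ) → Fin (M n))
    (hν : Tendsto (fun n => l n (ν n)) atTop atTop) :
    ∀ᵐ ω ∂μ, ∀ ε : ℝ, 0 < ε → ∀ᶠ n in atTop, ∀ k : Fin (M n), k ≤ ν n →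
      |SpikedCovariance.sampleEigenvalue (X n ω) (Fin.castLE (hA1 n).card_le k) / l n k - 1| < ε := by
  classical
  have hz := fun n => (hA2 n).isSubgaussianArray hK
  obtain ⟨a, C, ha, hC, hP⟩ := SpikedCovariance.exists_measure_exists_quadForm_le μ
    (Real.toNNReal (16 * (2 * K) ^ 2))
  have hlog : 0 < Real.log 25 := Real.log_pos (by norm_num)
  -- Chosen so that `a * D - C * a ^ 2 = γ * log 25 + 1`: the rate beats the entropy `N * log 25 ≤ γ
  -- * n * log 25` with room `n` to spare.
  let D : ℝ := (γ * Real.log 25 + 1 + C * a ^ 2) / a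
  have hD : 0 ≤ D := by positivity
  have hfull := SpikedCovariance.ae_eventually_quadForm_le hP hz (s := a) (δ := D) ha.le le_rfl hD
    one_pos (by
      filter_upwards [eventually_ge_atTop 1] with n hn
      have hn' : (0 : ℝ) < n := by exact_mod_cast hn
      have hN : (N n : ℝ) ≤ γ * n := (div_le_iff₀ hn').1 (hA3 n hn).2
      have h1 : a * D - C * a ^ 2 = γ * Real.log 25 + 1 := by
        simp only [D]; field_simp; ring
      rw [h1]
      nlinarith)
  -- Accuracies `1 / (q + 1)` form a countable family, so one null set serves them all.
  have hspiked : ∀ᵐ ω ∂μ, ∀ q : ℕ, ∀ᶠ n in atTop, ∀ x : EuclideanSpace ℝ (Fin (M n)),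
      |∑ j, (∑ i, x i * Z n ω (Fin.castLE (hA1 n).card_le i) j) ^ 2 - n * ‖x‖ ^ 2| ≤
        1 / ((q : ℝ) + 1) * (n * ‖x‖ ^ 2) := by
    rw [ae_all_iff]
    intro q
    let δ : ℝ := 1 / ((q : ℝ) + 1) / 8
    have hδ : 0 < δ := by positivity
    -- Small enough that `C * s ^ 2 ≤ s * δ / 2`. Of the remaining rate `s * δ / 2`, half absorbs
    -- the entropy `M * log 25 = o(n)` and half gives summability.
    let s := min a (δ / (2 * (C + 1)))
    have hs : 0 < s := lt_min ha (by positivity)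
    have hrate : s * δ / 2 ≤ s * δ - C * s ^ 2 := by
      have h1 : s * (2 * (C + 1)) ≤ δ := (le_div_iff₀ (by positivity)).1 (min_le_right _ _)
      nlinarith
    have h := SpikedCovariance.ae_eventually_quadForm_le hP
      (fun n => (hz n).precomp (Fin.castLE_injective (hA1 n).card_le)) (s := s) (δ := δ)
      hs.le (min_le_left _ _) hδ.le (η := s * δ / 4) (by positivity) (by
        have hsmall : ∀ᶠ n : ℕ in atTop, (M n : ℝ) / n < s * δ / 4 / Real.log 25 :=
          hA4.eventually_lt_const (by positivity)
        filter_upwards [hsmall, eventually_ge_atTop 1] with n hn hn1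
        have hn' : (0 : ℝ) < n := by exact_mod_cast hn1
        have h1 : (M n : ℝ) * Real.log 25 ≤ s * δ / 4 * n := by
          rw [div_lt_div_iff₀ hn' hlog] at hn
          exact hn.le
        nlinarith)
    have h8 : 8 * δ = 1 / ((q : ℝ) + 1) := by simp only [δ]; ring
    simpa only [h8] using h
  filter_upwards [hfull, hspiked] with ω h1 h2 ε hε
  obtain ⟨q, hq⟩ := exists_nat_one_div_lt (show 0 < ε / 6 by positivity)
  set e : ℝ := 1 / ((q : ℝ) + 1)
  have he : 0 < e := by positivity
  have he1 : e ≤ 1 := by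
    rw [div_le_one (by positivity)]
    linarith [Nat.cast_nonneg (α := ℝ) q]
  -- The threshold on `l n (ν n)` makes the additive error at most `ε / 2 * l n k` for all `k ≤ ν n`
  -- at once, by monotonicity of the spikes.
  filter_upwards [h1, h2 q, eventually_ge_atTop 1,
    hν.eventually_ge_atTop ((1 + 1 / e) * (1 + 8 * D) / (ε / 2))] with n hn1 hn2 hn hlν k hk
  have hlk : l n (ν n) ≤ l n k := (hA1 n).antitone hk
  have hlpos : 0 < l n k := zero_lt_one.trans_le ((hA1 n).one_le k)
  have hM := (hA1 n).card_le
  have hsup : ∀ y : Fin (N n) → ℝ, (∀ i : Fin (N n), M n ≤ (i : ℕ) → y i = 0) →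
      |SpikedCovariance.gram (Z n ω) y - n * ∑ i, y i ^ 2| ≤ e * (n * ∑ i, y i ^ 2) := by
    intro y hy
    obtain ⟨hg, hy2⟩ := SpikedCovariance.gram_eq_sum_of_support hM (Z n ω) hy
    have h := hn2 (WithLp.toLp 2 fun i => y (Fin.castLE hM i))
    rw [EuclideanSpace.real_norm_sq_eq] at h
    rw [hg, hy2]
    exact h
  rw [(hA2 n).eq ω]
  refine SpikedCovariance.abs_div_sub_one_lt (C := 1 + 8 * D) hlpos he he1 (by linarith)
    (((div_le_iff₀' (by positivity)).1 hlν).trans (by gcongr)) ?_ ?_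
  · refine SpikedCovariance.le_sampleEigenvalue_spiked hn (hA1 n).orthogonal hM (hA1 n).antitone
      (hA1 n).one_le _ he1 (fun y hy => ?_) k
    linarith [(abs_le.1 (hsup y hy)).1]
  · refine SpikedCovariance.sampleEigenvalue_spiked_le hn (hA1 n).orthogonal hM (hA1 n).antitone
      (hA1 n).one_le _ he (by positivity) (fun y hy => ?_) (fun y => ?_) k
    · linarith [(abs_le.1 (hsup y hy)).2]
    · have h := hn1 (WithLp.toLp 2 y)
      rw [EuclideanSpace.real_norm_sq_eq] at h
      rw [SpikedCovariance.gram_eq_sum]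
      linarith [(abs_le.1 h).2]
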